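/- Let $T=\{1324,1243,1234\}$, let $S_n(T)$ be the set of permutations of $\{1,\dots,n\}$ that avoid all three patterns in $T$, and let $F_T(x)=\sum_{n\ge 0}|S_n(T)|\,x^n$ be their ordinary generating function, a formal power series. Let $$v_-=\frac{2+(\sqrt5-1)x+\sqrt{4-12x+6x^2-4\sqrt5\,x-2\sqrt5\,x^2}}{4},\qquad v_+=\frac{2-(\sqrt5+1)x+\sqrt{4-12x+6x^2+4\sqrt5\,x+2\sqrt5\,x^2}}{4},$$ where the outer square roots denote the formal power series in $x$ with constant term $2$. Then $v_-$ and $v_+$ are roots of the kernel $$K(x,v)=xv(1-v^2)+x^2(1-3v+v^2)-v^2(1-v)^2,$$ that is, $K(x,v_-)=K(x,v_+)=0$, and $$F_T(x)=\frac{(v_--1)(v_+-1)\,\big((v_-+v_+)(v_-^2+v_+^2-x^2)+(x-1)(v_-^2+v_+^2+v_-v_+)\big)}{x\,\big(x-(v_--1)(v_+-1)(v_-^2+v_+^2+v_-v_++x(v_-+v_++2-x))\big)},$$ where the denominator is a nonzero formal power series and the quotient is taken in the field of formal Laurent series. -/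

import Mathlib

open scoped PowerSeries LaurentSeries

/-- The permutation `π` of `{0, …, n-1}`, read as the word `π 0, π 1, …`, contains the pattern `τ`:
some subsequence of `k` letters is in the same relative order as the word `τ 0, …, τ (k-1)`. -/
def ContainsPattern {n k : ℕ} (π : Equiv.Perm (Fin n)) (τ : Fin k → ℕ) : Prop :=
  ∃ f : Fin k ↪o Fin n, ∀ i j : Fin k, π (f i) < π (f j) ↔ τ i < τ j

/-- The set of patterns `T = {1324, 1243, 1234}`. -/
def patternsT : Set (Fin 4 → ℕ) := {![1, 3, 2, 4], ![1, 2, 4, 3], ![1, 2, 3, 4]}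

/-- The set `S_n(T)` of permutations of length `n` that avoid every pattern in `T`. -/
def avoiders (T : Set (Fin 4 → ℕ)) (n : ℕ) : Set (Equiv.Perm (Fin n)) :=
  {π | ∀ τ ∈ T, ¬ ContainsPattern π τ}

/-- The ordinary generating function `F_T(x) = ∑_{n ≥ 0} |S_n(T)| x ^ n`. -/
noncomputable def avoidersGF (T : Set (Fin 4 → ℕ)) : ℝ⟦X⟧ :=
  PowerSeries.mk fun n => ((avoiders T n).ncard : ℝ)

/-- The square root, with constant coefficient `√c`, of a formal power series `f` whose constant
coefficient `c` is positive: `√c * ∑_{k ≥ 0} (1/2 choose k) (f / c - 1) ^ k`. -/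
noncomputable def seriesSqrt (f : ℝ⟦X⟧) : ℝ⟦X⟧ :=
  PowerSeries.C (√(PowerSeries.constantCoeff f)) *
    (PowerSeries.binomialSeries ℝ (1 / 2 : ℝ)).subst
      (PowerSeries.C (PowerSeries.constantCoeff f)⁻¹ * f - 1)

theorem seriesSqrt_hasSubst {f : ℝ⟦X⟧} (hf : 0 < PowerSeries.constantCoeff f) :
    PowerSeries.HasSubst (PowerSeries.C (PowerSeries.constantCoeff f)⁻¹ * f - 1) :=
  PowerSeries.HasSubst.of_constantCoeff_zero' (by simp [hf.ne'])

/-- `seriesSqrt f` squares to `f`. -/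
theorem seriesSqrt_sq {f : ℝ⟦X⟧} (hf : 0 < PowerSeries.constantCoeff f) :
    seriesSqrt f ^ 2 = f := by
  have h := seriesSqrt_hasSubst hf
  have e : PowerSeries.binomialSeries ℝ (1 / 2 : ℝ) * PowerSeries.binomialSeries ℝ (1 / 2 : ℝ)
      = 1 + PowerSeries.X := by
    rw [← PowerSeries.binomialSeries_add]
    have := PowerSeries.binomialSeries_nat (R := ℝ) (A := ℝ) 1
    norm_num at this ⊢
    exact this
  unfold seriesSqrt
  rw [mul_pow, sq (PowerSeries.subst _ _), ← PowerSeries.subst_mul h, e, ← map_pow,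
    Real.sq_sqrt hf.le, PowerSeries.subst_add h, PowerSeries.subst_X h,
    ← PowerSeries.coe_substAlgHom h, map_one, add_sub_cancel, ← mul_assoc, ← map_mul,
    mul_inv_cancel₀ hf.ne', map_one, one_mul]

/-- The constant coefficient of `seriesSqrt f` is the positive square root. -/
theorem constantCoeff_seriesSqrt {f : ℝ⟦X⟧} (hf : 0 < PowerSeries.constantCoeff f) :
    PowerSeries.constantCoeff (seriesSqrt f) = √(PowerSeries.constantCoeff f) := by
  have h := seriesSqrt_hasSubst hf
  have h0 := PowerSeries.constantCoeff_subst_eq_zero (R := ℝ) (S := ℝ)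
    (a := PowerSeries.C (PowerSeries.constantCoeff f)⁻¹ * f - 1) (by
      change PowerSeries.constantCoeff _ = 0
      simp [hf.ne'])
    (PowerSeries.binomialSeries ℝ (1 / 2 : ℝ) - 1) (by simp)
  change PowerSeries.constantCoeff _ = 0 at h0
  rw [← PowerSeries.coe_substAlgHom h, map_sub, map_one, map_sub, map_one,
    PowerSeries.coe_substAlgHom h, sub_eq_zero] at h0
  unfold seriesSqrt
  rw [map_mul, h0, mul_one, PowerSeries.constantCoeff_C]

/-- `v₋ = (2 + (√5 - 1) x + √(4 - 12 x + 6 x² - 4 √5 x - 2 √5 x²)) / 4`. -/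
noncomputable def vMinus : ℝ⟦X⟧ :=
  PowerSeries.C (1 / 4) *
    (2 + PowerSeries.C (√5 - 1) * PowerSeries.X +
      seriesSqrt (4 - 12 * PowerSeries.X + 6 * PowerSeries.X ^ 2
        - PowerSeries.C (4 * √5) * PowerSeries.X - PowerSeries.C (2 * √5) * PowerSeries.X ^ 2))

/-- `v₊ = (2 - (√5 + 1) x + √(4 - 12 x + 6 x² + 4 √5 x + 2 √5 x²)) / 4`. -/
noncomputable def vPlus : ℝ⟦X⟧ :=
  PowerSeries.C (1 / 4) *
    (2 - PowerSeries.C (√5 + 1) * PowerSeries.X +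
      seriesSqrt (4 - 12 * PowerSeries.X + 6 * PowerSeries.X ^ 2
        + PowerSeries.C (4 * √5) * PowerSeries.X + PowerSeries.C (2 * √5) * PowerSeries.X ^ 2))

/-- The kernel `K(x, v) = x v (1 - v²) + x² (1 - 3 v + v²) - v² (1 - v)²`. -/
noncomputable def kernelK (v : ℝ⟦X⟧) : ℝ⟦X⟧ :=
  PowerSeries.X * v * (1 - v ^ 2) + PowerSeries.X ^ 2 * (1 - 3 * v + v ^ 2)
    - v ^ 2 * (1 - v) ^ 2

/-! Each pattern in T is a smallest first letter followed by 123, 132 or 213. Build avoiders by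
prepending a first letter `a`: this is allowed exactly when the letters of value at least `a`
contain no such triple (`consPerm_mem_avoiders`). The labels of the children depend only on the
label (k, b) of the parent, where k is `freeTop` and b records `TopAscent` (`sum_consPerm`).

The kernel method then applies. For a root v of the kernel with constant term 1, a weight geometric
in k with ratio 1/v makes the sum over the tree telescope, which leaves one linear equation in the
generating functions of the two flag values (`flagGF_relation_of_kernelK`). The kernel splits into
two quadratics over ℚ(√5), with v₋ a root of one and v₊ of the other, so there are two equations for
two unknowns. Their determinant is nonzero, and elimination gives the formula
(`avoidersGF_relation`). -/

/-- The word `a b c` has one of the relative orders `123`, `132`, `213`. -/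
def FormsTriple (a b c : ℕ) : Prop :=
  (a < b ∧ b < c) ∨ (a < c ∧ c < b) ∨ (b < a ∧ a < c)

/-- The letters of `π` with value at least `m` avoid the patterns `123`, `132` and `213`. -/
def TripleFreeAbove {n : ℕ} (π : Equiv.Perm (Fin n)) (m : ℕ) : Prop :=
  ∀ i j k : Fin n, i < j → j < k → m ≤ π i → m ≤ π j → m ≤ π k →
    ¬ FormsTriple (π i) (π j) (π k)

theorem TripleFreeAbove.mono {n : ℕ} {π : Equiv.Perm (Fin n)} {m m' : ℕ}
    (h : TripleFreeAbove π m) (hm : m ≤ m') : TripleFreeAbove π m' :=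
  fun i j k hij hjk hi hj hk => h i j k hij hjk (hm.trans hi) (hm.trans hj) (hm.trans hk)

theorem containsPattern_four {n : ℕ} (π : Equiv.Perm (Fin n)) (τ : Fin 4 → ℕ) :
    ContainsPattern π τ ↔ ∃ a b c d : Fin n, a < b ∧ b < c ∧ c < d ∧
      ∀ i j : Fin 4, π (![a, b, c, d] i) < π (![a, b, c, d] j) ↔ τ i < τ j := by
  constructor
  · rintro ⟨f, hf⟩
    refine ⟨f 0, f 1, f 2, f 3, by simp, by simp, by simp, ?_⟩
    have : ![f 0, f 1, f 2, f 3] = f := by ext i; fin_cases i <;> rfl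
    rw [this]
    exact hf
  · rintro ⟨a, b, c, d, hab, hbc, hcd, h⟩
    refine ⟨OrderEmbedding.ofStrictMono ![a, b, c, d] ?_, h⟩
    rw [Fin.strictMono_iff_lt_succ]
    intro i
    fin_cases i <;> simpa

theorem mem_avoiders_patternsT_iff {n : ℕ} (π : Equiv.Perm (Fin n)) :
    π ∈ avoiders patternsT n ↔ ∀ a b c d : Fin n, a < b → b < c → c < d →
      π a < π b → π a < π c → π a < π d → ¬ FormsTriple (π b) (π c) (π d) := by
  simp only [avoiders, patternsT, Set.mem_ofPred_eq, Set.mem_insert_iff, Set.mem_singleton_iff,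
    forall_eq_or_imp, forall_eq, containsPattern_four, Fin.forall_fin_succ, FormsTriple]
  simp only [Fin.lt_def]
  constructor
  · rintro ⟨h1, h2, h3⟩ a b c d hab hbc hcd h₁ h₂ h₃ h
    rcases h with h | h | h
    · exact h3 ⟨a, b, c, d, hab, hbc, hcd, by simp; omega⟩
    · exact h2 ⟨a, b, c, d, hab, hbc, hcd, by simp; omega⟩
    · exact h1 ⟨a, b, c, d, hab, hbc, hcd, by simp; omega⟩
  · intro h
    refine ⟨?_, ?_, ?_⟩ <;> rintro ⟨a, b, c, d, hab, hbc, hcd, H⟩ <;>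
      refine h a b c d hab hbc hcd ?_ ?_ ?_ ?_ <;> simp at H <;> omega

/-! ### Prepending a first letter -/

/-- The permutation whose first letter is `a` and whose remaining letters are ordered like `π`. -/
def consPerm {n : ℕ} (a : Fin (n + 1)) (π : Equiv.Perm (Fin n)) : Equiv.Perm (Fin (n + 1)) :=
  (finSuccEquiv' 0).trans ((Equiv.optionCongr π).trans (finSuccEquiv' a).symm)

@[simp] theorem consPerm_zero {n : ℕ} (a : Fin (n + 1)) (π : Equiv.Perm (Fin n)) :
    consPerm a π 0 = a := by
  simp [consPerm]

@[simp] theorem consPerm_succ {n : ℕ} (a : Fin (n + 1)) (π : Equiv.Perm (Fin n)) (i : Fin n) :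
    consPerm a π i.succ = a.succAbove (π i) := by
  have : finSuccEquiv' (0 : Fin (n + 1)) i.succ = some i := by
    rw [← Fin.succAbove_zero, finSuccEquiv'_succAbove]
  rw [consPerm, Equiv.trans_apply, this]
  simp

theorem consPerm_bijective (n : ℕ) :
    Function.Bijective fun p : Fin (n + 1) × Equiv.Perm (Fin n) => consPerm p.1 p.2 := by
  rw [Fintype.bijective_iff_injective_and_card]
  constructor
  · rintro ⟨a, π⟩ ⟨b, σ⟩ h
    have h0 : a = b := by simpa using congrArg (fun p => p 0) h
    subst h0
    simp only [Prod.mk.injEq, true_and]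
    ext i
    have := congrArg (fun p => p i.succ) h
    simp only [consPerm_succ] at this
    rw [Fin.succAbove_right_injective this]
  · simp [Fintype.card_perm, Nat.factorial_succ]

theorem val_succAbove {n : ℕ} (a : Fin (n + 1)) (i : Fin n) :
    ((a.succAbove i : Fin (n + 1)) : ℕ) = if (i : ℕ) < a then (i : ℕ) else i + 1 := by
  simp only [Fin.succAbove, Fin.lt_def, Fin.val_castSucc]
  split <;> simp

theorem formsTriple_succAbove {n : ℕ} (a : Fin (n + 1)) (x y z : Fin n) :
    FormsTriple (a.succAbove x) (a.succAbove y) (a.succAbove z) ↔ FormsTriple x y z := by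
  simp only [FormsTriple, val_succAbove]
  split_ifs <;> omega

/-- A forbidden pattern either lies inside π or uses the new letter, necessarily as its smallest
letter. The letters of π that end up above `a` are those of value at least `a` before relabelling.
-/
theorem consPerm_mem_avoiders {n : ℕ} (a : Fin (n + 1)) (π : Equiv.Perm (Fin n)) :
    consPerm a π ∈ avoiders patternsT (n + 1) ↔
      π ∈ avoiders patternsT n ∧ TripleFreeAbove π a := by
  rw [mem_avoiders_patternsT_iff, mem_avoiders_patternsT_iff]
  constructor
  · intro h
    refine ⟨fun i j k l hij hjk hkl h1 h2 h3 => ?_, fun j k l hjk hkl h1 h2 h3 => ?_⟩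
    · have := h i.succ j.succ k.succ l.succ (by simpa) (by simpa) (by simpa)
        (by simpa) (by simpa) (by simpa)
      simpa only [consPerm_succ, formsTriple_succAbove] using this
    · have := h 0 j.succ k.succ l.succ (by simp) (by simpa) (by simpa)
      simp only [consPerm_succ, consPerm_zero, formsTriple_succAbove] at this
      simp only [Fin.lt_def, val_succAbove] at this
      refine this ?_ ?_ ?_ <;> split_ifs <;> omega
  · rintro ⟨h, hg⟩ i j k l hij hjk hkl h1 h2 h3
    obtain ⟨l, rfl⟩ := Fin.exists_succ_eq.mpr (Fin.ne_zero_of_lt hkl)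
    obtain ⟨k, rfl⟩ := Fin.exists_succ_eq.mpr (Fin.ne_zero_of_lt hjk)
    obtain ⟨j, rfl⟩ := Fin.exists_succ_eq.mpr (Fin.ne_zero_of_lt hij)
    rcases Fin.eq_zero_or_eq_succ i with rfl | ⟨i, rfl⟩
    · simp only [consPerm_succ, consPerm_zero, formsTriple_succAbove] at h1 h2 h3 ⊢
      simp only [Fin.lt_def, val_succAbove] at h1 h2 h3
      refine hg j k l (by simpa using hjk) (by simpa using hkl) ?_ ?_ ?_
      · split_ifs at h1 <;> omega
      · split_ifs at h2 <;> omega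
      · split_ifs at h3 <;> omega
    · simp only [consPerm_succ, formsTriple_succAbove] at h1 h2 h3 ⊢
      exact h i j k l (by simpa using hij) (by simpa using hjk) (by simpa using hkl)
        (by simpa using h1) (by simpa using h2) (by simpa using h3)

theorem tripleFreeAbove_consPerm {n : ℕ} (a : Fin (n + 1)) (π : Equiv.Perm (Fin n)) {m : ℕ}
    (hm : m ≤ a) :
    TripleFreeAbove (consPerm a π) m ↔ TripleFreeAbove π m ∧
      ∀ i j : Fin n, i < j → m ≤ π i → m ≤ π j →
        ¬ FormsTriple a (a.succAbove (π i)) (a.succAbove (π j)) := by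
  have key (x : Fin n) : m ≤ (a.succAbove x : ℕ) ↔ m ≤ (x : ℕ) := by
    rw [val_succAbove]; split_ifs <;> omega
  constructor
  · intro h
    refine ⟨fun i j k hij hjk h1 h2 h3 => ?_, fun j k hjk h1 h2 => ?_⟩
    · have := h i.succ j.succ k.succ (by simpa) (by simpa)
      simp only [consPerm_succ, formsTriple_succAbove, key] at this
      exact this h1 h2 h3
    · have := h 0 j.succ k.succ (by simp) (by simpa)
      simp only [consPerm_succ, consPerm_zero, key] at this
      exact this hm h1 h2
  · rintro ⟨h, hg⟩ i j k hij hjk h1 h2 h3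
    obtain ⟨k, rfl⟩ := Fin.exists_succ_eq.mpr (Fin.ne_zero_of_lt hjk)
    obtain ⟨j, rfl⟩ := Fin.exists_succ_eq.mpr (Fin.ne_zero_of_lt hij)
    rcases Fin.eq_zero_or_eq_succ i with rfl | ⟨i, rfl⟩
    · simp only [consPerm_succ, consPerm_zero, key] at h1 h2 h3 ⊢
      exact hg j k (by simpa using hjk) h2 h3
    · simp only [consPerm_succ, formsTriple_succAbove, key] at h1 h2 h3 ⊢
      exact h i j k (by simpa using hij) (by simpa using hjk) h1 h2 h3

theorem TripleFreeAbove.consPerm_of_lt {n : ℕ} {a : Fin (n + 1)} {π : Equiv.Perm (Fin n)} {m : ℕ}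
    (hπ : TripleFreeAbove π a) (hm : (a : ℕ) < m) : TripleFreeAbove (consPerm a π) m := by
  have key (x : Fin n) (hx : m ≤ (a.succAbove x : ℕ)) : (a : ℕ) ≤ x := by
    rw [val_succAbove] at hx; split_ifs at hx <;> omega
  rintro i j k hij hjk h1 h2 h3
  obtain ⟨k, rfl⟩ := Fin.exists_succ_eq.mpr (Fin.ne_zero_of_lt hjk)
  obtain ⟨j, rfl⟩ := Fin.exists_succ_eq.mpr (Fin.ne_zero_of_lt hij)
  rcases Fin.eq_zero_or_eq_succ i with rfl | ⟨i, rfl⟩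
  · simp only [consPerm_zero] at h1
    omega
  · simp only [consPerm_succ, formsTriple_succAbove] at h1 h2 h3 ⊢
    exact hπ i j k (by simpa using hij) (by simpa using hjk) (key _ h1) (key _ h2) (key _ h3)

/-! ### Labels and how prepending changes them -/

open Classical in
/-- The largest `k` such that the `k` largest letters of `π` avoid `123`, `132` and `213`. -/
noncomputable def freeTop {n : ℕ} (π : Equiv.Perm (Fin n)) : ℕ :=
  n - Nat.find (p := TripleFreeAbove π) ⟨n, fun i _ _ _ _ hi => absurd hi (by omega)⟩

theorem freeTop_le {n : ℕ} (π : Equiv.Perm (Fin n)) : freeTop π ≤ n := Nat.sub_le _ _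

theorem tripleFreeAbove_iff {n : ℕ} (π : Equiv.Perm (Fin n)) (m : ℕ) :
    TripleFreeAbove π m ↔ n ≤ m + freeTop π := by
  classical
  have hex : ∃ m, TripleFreeAbove π m := ⟨n, fun i _ _ _ _ hi => absurd hi (by omega)⟩
  have h1 : Nat.find hex ≤ n := Nat.find_le fun i _ _ _ _ hi => absurd hi (by omega)
  have h2 : TripleFreeAbove π m ↔ Nat.find hex ≤ m :=
    ⟨fun h => Nat.find_le h, fun h => (Nat.find_spec hex).mono h⟩
  rw [h2, freeTop]
  omega

theorem freeTop_eq_of_iff {n k : ℕ} {π : Equiv.Perm (Fin n)} (hk : k ≤ n)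
    (h : ∀ m, TripleFreeAbove π m ↔ n ≤ m + k) : freeTop π = k := by
  have h1 := (tripleFreeAbove_iff π (n - k)).symm.trans (h _)
  have h2 := (tripleFreeAbove_iff π (n - freeTop π)).symm.trans (h _)
  have := freeTop_le π
  omega

/-- The second largest letter of `π` precedes the largest one. -/
def TopAscent {n : ℕ} (π : Equiv.Perm (Fin n)) : Prop :=
  ∃ i j : Fin n, i < j ∧ (π i : ℕ) + 2 = n ∧ (π j : ℕ) + 1 = n

theorem exists_apply_val_eq {n : ℕ} (π : Equiv.Perm (Fin n)) {m : ℕ} (hm : m < n) :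
    ∃ i, (π i : ℕ) = m := ⟨π.symm ⟨m, hm⟩, by simp⟩

theorem one_le_freeTop {n : ℕ} (π : Equiv.Perm (Fin (n + 1))) : 1 ≤ freeTop π := by
  have : TripleFreeAbove π n := fun i j _ hij _ hi hj =>
    absurd (π.injective (Fin.ext (by omega : (π i : ℕ) = π j))) hij.ne
  have := (tripleFreeAbove_iff π n).1 this
  omega

/-- The first letter of 123, 132 or 213 is never the largest, so a leading maximum creates no
triple. -/
theorem freeTop_consPerm_last {n : ℕ} (π : Equiv.Perm (Fin n)) :
    freeTop (consPerm (Fin.last n) π) = freeTop π + 1 := by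
  refine freeTop_eq_of_iff (by have := freeTop_le π; omega) fun m => ?_
  rcases le_or_gt m n with hm | hm
  · rw [tripleFreeAbove_consPerm _ _ (by simpa), tripleFreeAbove_iff]
    refine ⟨fun h => by omega, fun h => ⟨by omega, fun i j _ _ _ => ?_⟩⟩
    simp only [FormsTriple, Fin.succAbove_last, Fin.val_last, Fin.val_castSucc]
    omega
  · refine iff_of_true (TripleFreeAbove.consPerm_of_lt ?_ (by simpa)) (by omega)
    rw [tripleFreeAbove_iff]
    simp

theorem not_topAscent_consPerm_last {n : ℕ} (π : Equiv.Perm (Fin n)) :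
    ¬ TopAscent (consPerm (Fin.last n) π) := by
  rintro ⟨i, j, hij, -, hj⟩
  obtain ⟨j, rfl⟩ := Fin.exists_succ_eq.mpr (Fin.ne_zero_of_lt hij)
  simp at hj
  omega

/-- The two largest letters of π stay above `a` and form 123 or 132 with it, so only the letters
strictly above `a` remain free. -/
theorem freeTop_consPerm_of_two_le {n : ℕ} (π : Equiv.Perm (Fin n)) (a : Fin (n + 1))
    (ha : (a : ℕ) + 2 ≤ n) (hπ : TripleFreeAbove π a) :
    freeTop (consPerm a π) = n - a := by
  refine freeTop_eq_of_iff (by omega) fun m => ?_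
  rcases le_or_gt m a with hm | hm
  · refine iff_of_false (fun h => ?_) (by omega)
    rw [tripleFreeAbove_consPerm _ _ hm] at h
    obtain ⟨i, hi⟩ := exists_apply_val_eq π (show n - 2 < n by omega)
    obtain ⟨j, hj⟩ := exists_apply_val_eq π (show n - 1 < n by omega)
    have hne : i ≠ j := by rintro rfl; omega
    have h2 := h.2
    simp only [FormsTriple, val_succAbove] at h2
    rcases lt_or_gt_of_ne hne with hij | hij
    · refine h2 i j hij (by omega) (by omega) ?_
      split_ifs <;> omega
    · refine h2 j i hij (by omega) (by omega) ?_
      split_ifs <;> omega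
  · exact iff_of_true (hπ.consPerm_of_lt hm) (by omega)

theorem topAscent_consPerm_of_two_le {n : ℕ} (π : Equiv.Perm (Fin n)) (a : Fin (n + 1))
    (ha : (a : ℕ) + 2 ≤ n) : TopAscent (consPerm a π) ↔ TopAscent π := by
  constructor
  · rintro ⟨i, j, hij, hi, hj⟩
    obtain ⟨j, rfl⟩ := Fin.exists_succ_eq.mpr (Fin.ne_zero_of_lt hij)
    rcases Fin.eq_zero_or_eq_succ i with rfl | ⟨i, rfl⟩
    · simp only [consPerm_zero] at hi
      omega
    · refine ⟨i, j, by simpa using hij, ?_⟩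
      simp only [consPerm_succ, val_succAbove] at hi hj
      split_ifs at hi hj <;> omega
  · rintro ⟨i, j, hij, hi, hj⟩
    refine ⟨i.succ, j.succ, by simpa, ?_⟩
    simp only [consPerm_succ, val_succAbove]
    split_ifs <;> omega

theorem topAscent_consPerm_of_one {n : ℕ} (π : Equiv.Perm (Fin n)) (a : Fin (n + 1))
    (ha : (a : ℕ) + 1 = n) : TopAscent (consPerm a π) := by
  obtain ⟨j, hj⟩ := exists_apply_val_eq π (show n - 1 < n by omega)
  refine ⟨0, j.succ, by simp, ?_⟩
  simp only [consPerm_zero, consPerm_succ, val_succAbove]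
  split_ifs <;> omega

theorem freeTop_consPerm_of_topAscent {n : ℕ} (π : Equiv.Perm (Fin n)) (a : Fin (n + 1))
    (ha : (a : ℕ) + 1 = n) (hπ : TripleFreeAbove π a) (hasc : TopAscent π) :
    freeTop (consPerm a π) = 2 := by
  obtain ⟨i, j, hij, hi, hj⟩ := hasc
  refine freeTop_eq_of_iff (by omega) fun m => ?_
  rcases le_or_gt m a with hm | hm
  · rw [tripleFreeAbove_consPerm _ _ hm]
    constructor
    · rintro ⟨-, h⟩
      by_contra hlt
      -- The new letter, the old second largest and the maximum form 213.
      refine h i j hij (by omega) (by omega) ?_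
      simp only [FormsTriple, val_succAbove]
      split_ifs <;> omega
    · intro h
      refine ⟨(show m = a by omega) ▸ hπ, fun k l hkl hk hl => ?_⟩
      have : π k = π l := Fin.ext (by omega)
      exact absurd (π.injective this) hkl.ne
  · exact iff_of_true (hπ.consPerm_of_lt hm) (by omega)

theorem freeTop_consPerm_of_not_topAscent {n : ℕ} (π : Equiv.Perm (Fin n)) (a : Fin (n + 1))
    (ha : (a : ℕ) + 1 = n) (hπ : TripleFreeAbove π a) (hasc : ¬ TopAscent π) :
    freeTop (consPerm a π) = freeTop π + 1 := by
  refine freeTop_eq_of_iff (by have := freeTop_le π; omega) fun m => ?_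
  rcases le_or_gt m a with hm | hm
  · rw [tripleFreeAbove_consPerm _ _ hm]
    have hiff : TripleFreeAbove π m ↔ n + 1 ≤ m + (freeTop π + 1) := by
      rw [tripleFreeAbove_iff]; omega
    rw [← hiff, and_iff_left_iff_imp]
    intro h i j hij hi hj hf
    simp only [FormsTriple, val_succAbove] at hf
    have hne : (π i : ℕ) ≠ π j := fun e => hij.ne (π.injective (Fin.ext e))
    -- Only the maximum lies above the new letter, so a triple led by it must be a 213 ending at the
    -- maximum.
    have h1 : (π j : ℕ) + 1 = n ∧ (π i : ℕ) + 1 < n := by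
      split_ifs at hf <;> omega
    obtain ⟨l, hl⟩ := exists_apply_val_eq π (show n - 2 < n by omega)
    have hlj : l ≠ j := by rintro rfl; omega
    rcases lt_or_gt_of_ne hlj with h2 | h2
    · exact hasc ⟨l, j, h2, by omega, h1.1⟩
    · have hil : (π i : ℕ) ≠ π l := fun e => (hij.trans h2).ne (π.injective (Fin.ext e))
      -- Without a top ascent the second largest letter follows the maximum, so π itself already has
      -- a 132 at i, j, l.
      refine h i j l hij h2 hi hj (by omega) ?_
      simp only [FormsTriple]
      omega
  · exact iff_of_true (hπ.consPerm_of_lt hm) (by have := freeTop_le π; have := hπ; rw [tripleFreeAbove_iff] at this; omega)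

/-! ### The generating tree -/

open Classical in
/-- The sum of `f (freeTop π) (TopAscent π)` over the avoiders `π` of length `n`. -/
noncomputable def avoiderSum {R : Type*} [AddCommMonoid R] (n : ℕ) (f : ℕ → Bool → R) : R :=
  ∑ π : Equiv.Perm (Fin n) with π ∈ avoiders patternsT n, f (freeTop π) (decide (TopAscent π))

/-- The sum of `f` over the labels of the children of a node labelled `(k, b)` in the generating
tree of the avoiders. -/
def childSum {R : Type*} [AddCommMonoid R] (f : ℕ → Bool → R) (k : ℕ) (b : Bool) : R :=
  f (k + 1) false + (bif b then f 2 true else f (k + 1) true) + ∑ j ∈ Finset.Ico 2 (k + 1), f j b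

open Classical in
theorem sum_consPerm {R : Type*} [AddCommMonoid R] {n : ℕ} (π : Equiv.Perm (Fin (n + 1)))
    (f : ℕ → Bool → R) :
    ∑ a ∈ Finset.univ.filter (fun a : Fin (n + 2) => TripleFreeAbove π a),
      f (freeTop (consPerm a π)) (decide (TopAscent (consPerm a π))) =
    childSum f (freeTop π) (decide (TopAscent π)) := by
  have hk := one_le_freeTop π
  have hk' := freeTop_le π
  have hsub : Finset.range (freeTop π + 1) ⊆ Finset.range (n + 2) :=
    Finset.range_subset_range.2 (by omega)
  -- Reindex by the number j of letters above the new one. The admissible values are 0 ≤ j ≤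
  -- `freeTop π`; j = 0 and j = 1 are the exceptional children.
  have h1 : ∑ a ∈ Finset.univ.filter (fun a : Fin (n + 2) => TripleFreeAbove π a),
      f (freeTop (consPerm a π)) (decide (TopAscent (consPerm a π))) =
      ∑ j ∈ Finset.range (freeTop π + 1),
        f (freeTop (consPerm (Fin.ofNat (n + 2) (n + 1 - j)) π))
          (decide (TopAscent (consPerm (Fin.ofNat (n + 2) (n + 1 - j)) π))) := by
    refine Finset.sum_bij' (fun a _ => n + 1 - a) (fun j _ => Fin.ofNat (n + 2) (n + 1 - j))
      ?_ ?_ ?_ ?_ ?_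
    · intro a ha
      simp only [Finset.mem_filter, Finset.mem_univ, true_and, tripleFreeAbove_iff] at ha
      simp only [Finset.mem_range]
      omega
    · intro j hj
      rw [Finset.mem_range] at hj
      simp only [Finset.mem_filter, Finset.mem_univ, true_and, tripleFreeAbove_iff, Fin.val_ofNat]
      rw [Nat.mod_eq_of_lt (by omega)]
      omega
    · intro a _
      ext
      simp only [Fin.val_ofNat]
      rw [Nat.mod_eq_of_lt (by omega)]
      omega
    · intro j hj
      simp only [Finset.mem_range] at hj
      simp only [Fin.val_ofNat]
      rw [Nat.mod_eq_of_lt (by omega)]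
      omega
    · intro a _
      have : Fin.ofNat (n + 2) (n + 1 - (n + 1 - (a : ℕ))) = a := by
        ext
        simp only [Fin.val_ofNat]
        rw [Nat.mod_eq_of_lt (by omega)]
        omega
      rw [this]
  have hval (j : ℕ) : (Fin.ofNat (n + 2) (n + 1 - j) : ℕ) = n + 1 - j := by
    simp only [Fin.val_ofNat]
    exact Nat.mod_eq_of_lt (by omega)
  have hfree (j : ℕ) (hj : j ≤ freeTop π) :
      TripleFreeAbove π (Fin.ofNat (n + 2) (n + 1 - j) : Fin (n + 2)) := by
    rw [tripleFreeAbove_iff, hval]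
    omega
  rw [h1, Finset.range_eq_Ico, Finset.sum_eq_sum_Ico_succ_bot (by omega),
    Finset.sum_eq_sum_Ico_succ_bot (by omega), childSum, ← add_assoc]
  congr 1
  · congr 1
    · have : Fin.ofNat (n + 2) (n + 1 - 0) = Fin.last (n + 1) := Fin.ext (hval 0)
      rw [this, freeTop_consPerm_last, decide_eq_false (not_topAscent_consPerm_last π)]
    · rw [zero_add]
      have h := hval 1
      rw [decide_eq_true (topAscent_consPerm_of_one π _ (by omega))]
      by_cases hasc : TopAscent π
      · rw [freeTop_consPerm_of_topAscent π _ (by omega) (hfree 1 hk) hasc]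
        simp [hasc]
      · rw [freeTop_consPerm_of_not_topAscent π _ (by omega) (hfree 1 hk) hasc]
        simp [hasc]
  · refine Finset.sum_congr rfl fun j hj => ?_
    rw [Finset.mem_Ico] at hj
    have h := hval j
    rw [freeTop_consPerm_of_two_le π _ (by omega) (hfree j (by omega)), h]
    simp only [topAscent_consPerm_of_two_le π (Fin.ofNat (n + 2) (n + 1 - j)) (by omega)]
    congr 1
    omega

theorem avoiderSum_add_two {R : Type*} [AddCommMonoid R] (n : ℕ) (f : ℕ → Bool → R) :
    avoiderSum (n + 2) f = avoiderSum (n + 1) (childSum f) := by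
  classical
  rw [avoiderSum, Finset.sum_filter,
    ← Function.Bijective.sum_comp (consPerm_bijective (n + 1)), Fintype.sum_prod_type_right,
    avoiderSum, Finset.sum_filter]
  refine Finset.sum_congr rfl fun π _ => ?_
  simp only [consPerm_mem_avoiders]
  split_ifs with h
  · simp only [h, true_and]
    rw [← sum_consPerm π f, Finset.sum_filter]
  · simp [h]

theorem avoiderSum_one {R : Type*} [AddCommMonoid R] (f : ℕ → Bool → R) :
    avoiderSum 1 f = f 1 false := by
  classical
  have hmem (π : Equiv.Perm (Fin 1)) : π ∈ avoiders patternsT 1 := by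
    rw [mem_avoiders_patternsT_iff]
    intro a b _ _ hab
    omega
  have hasc (π : Equiv.Perm (Fin 1)) : ¬ TopAscent π := by
    rintro ⟨i, j, hij, -⟩
    omega
  have hfree (π : Equiv.Perm (Fin 1)) : freeTop π = 1 :=
    le_antisymm (freeTop_le π) (one_le_freeTop π)
  simp [avoiderSum, hmem, hasc, hfree]

theorem natCast_ncard_avoiders (R : Type*) [Semiring R] (n : ℕ) :
    ((avoiders patternsT n).ncard : R) = avoiderSum n fun _ _ => 1 := by
  classical
  rw [avoiderSum, Finset.sum_const, nsmul_one, Set.ncard_eq_toFinset_card']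
  congr 2
  ext
  simp

/-! ### Kernel method -/

/-- The generating function `∑ₙ aₙ xⁿ`, where `aₙ` counts the avoiders `π` of length `n + 1` for
which the truth value of `TopAscent π` is `b`. -/
noncomputable def flagGF (b : Bool) : ℝ⟦X⟧ :=
  PowerSeries.mk fun n => avoiderSum (n + 1) fun _ c => if c = b then 1 else 0

theorem avoidersGF_eq_flagGF :
    avoidersGF patternsT = 1 + PowerSeries.X * (flagGF false + flagGF true) := by
  ext n
  rcases n with _ | n
  · have hmem (π : Equiv.Perm (Fin 0)) : π ∈ avoiders patternsT 0 := by
      rw [mem_avoiders_patternsT_iff]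
      intro a
      exact a.elim0
    rw [avoidersGF, PowerSeries.coeff_mk, natCast_ncard_avoiders]
    simp [avoiderSum, hmem]
  · rw [avoidersGF, PowerSeries.coeff_mk, natCast_ncard_avoiders, map_add,
      PowerSeries.coeff_succ_X_mul, map_add, flagGF, flagGF, PowerSeries.coeff_mk,
      PowerSeries.coeff_mk, PowerSeries.coeff_one, if_neg n.succ_ne_zero, zero_add]
    simp only [avoiderSum]
    rw [← Finset.sum_add_distrib]
    refine Finset.sum_congr rfl fun π _ => ?_
    by_cases h : TopAscent π <;> simp [h]

theorem avoiderSum_bif (n : ℕ) (α β : ℝ⟦X⟧) :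
    avoiderSum (n + 1) (fun _ c => bif c then β else α) =
      α * PowerSeries.C (PowerSeries.coeff n (flagGF false)) +
        β * PowerSeries.C (PowerSeries.coeff n (flagGF true)) := by
  simp only [flagGF, PowerSeries.coeff_mk, avoiderSum, map_sum, Finset.mul_sum]
  rw [← Finset.sum_add_distrib]
  refine Finset.sum_congr rfl fun π _ => ?_
  by_cases h : TopAscent π <;> simp [h]

theorem X_pow_dvd_sub_sum (f : ℝ⟦X⟧) (N : ℕ) :
    PowerSeries.X ^ N ∣ f - ∑ i ∈ Finset.range N,
      PowerSeries.X ^ i * PowerSeries.C (PowerSeries.coeff i f) := by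
  rw [PowerSeries.X_pow_dvd_iff]
  intro m hm
  simp [PowerSeries.coeff_X_pow, Finset.sum_ite_eq, PowerSeries.coeff_mul_C, hm]

theorem eq_zero_of_forall_X_pow_dvd {f : ℝ⟦X⟧} (h : ∀ N, PowerSeries.X ^ N ∣ f) : f = 0 := by
  ext n
  exact PowerSeries.X_pow_dvd_iff.1 (h (n + 1)) n n.lt_succ_self

/-- A weight on labels whose sums over children reproduce it up to a correction depending only on
the flag yields a linear relation between the two flag generating functions. -/
theorem flagGF_relation_of_childSum (f : ℕ → Bool → ℝ⟦X⟧) (α β : ℝ⟦X⟧)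
    (hf : ∀ k b, 1 ≤ k → PowerSeries.X * childSum f k b = f k b - bif b then β else α) :
    α * flagGF false + β * flagGF true = f 1 false := by
  have hstep (n : ℕ) : PowerSeries.X * avoiderSum (n + 2) f = avoiderSum (n + 1) f -
      (α * PowerSeries.C (PowerSeries.coeff n (flagGF false)) +
        β * PowerSeries.C (PowerSeries.coeff n (flagGF true))) := by
    rw [avoiderSum_add_two, ← avoiderSum_bif, avoiderSum, avoiderSum, avoiderSum, Finset.mul_sum,
      ← Finset.sum_sub_distrib]
    exact Finset.sum_congr rfl fun π _ => hf _ _ (one_le_freeTop π)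
  -- Telescoping over levels; the remainder is divisible by X ^ N, hence vanishes X-adically.
  have htel (N : ℕ) : α * ∑ i ∈ Finset.range N,
        PowerSeries.X ^ i * PowerSeries.C (PowerSeries.coeff i (flagGF false)) +
      β * ∑ i ∈ Finset.range N,
        PowerSeries.X ^ i * PowerSeries.C (PowerSeries.coeff i (flagGF true)) =
      f 1 false - PowerSeries.X ^ N * avoiderSum (N + 1) f := by
    induction N with
    | zero => simp [avoiderSum_one]
    | succ N ih =>
      rw [Finset.sum_range_succ, Finset.sum_range_succ]
      linear_combination ih + PowerSeries.X ^ N * hstep N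
  rw [← sub_eq_zero]
  refine eq_zero_of_forall_X_pow_dvd fun N => ?_
  obtain ⟨g, hg⟩ := X_pow_dvd_sub_sum (flagGF false) N
  obtain ⟨h, hh⟩ := X_pow_dvd_sub_sum (flagGF true) N
  exact ⟨α * g + β * h - avoiderSum (N + 1) f,
    by linear_combination α * hg + β * hh + htel N⟩

/-- The relation given by a root of the kernel that has constant coefficient `1`. -/
theorem flagGF_relation_of_kernelK {v : ℝ⟦X⟧} (hv : PowerSeries.constantCoeff v = 1)
    (hK : kernelK v = 0) :
    PowerSeries.X * (1 - v - PowerSeries.X) * v ^ 2 * flagGF false -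
      PowerSeries.X ^ 2 * (1 - v) * (1 - 2 * v) * flagGF true =
      (1 - v) * (1 - v - PowerSeries.X) * v ^ 2 := by
  obtain ⟨u, hu⟩ : ∃ u, v * u = 1 := ⟨v⁻¹, PowerSeries.mul_inv_cancel v (by simp [hv])⟩
  rw [kernelK] at hK
  generalize hx : (PowerSeries.X : ℝ⟦X⟧) = x at hK ⊢
  have h1 : u - 1 = u * (1 - v) := by linear_combination hu
  have h2 : u - 2 = u * (1 - 2 * v) := by linear_combination 2 * hu
  have h3 : u - 1 - x * u = u * (1 - v - x) := by linear_combination hu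
  have h4 : u - 1 - x * u ^ 2 = u ^ 2 * (v - v ^ 2 - x) := by
    linear_combination (u * v + 1 - u) * hu
  have hker : (u - 1 - x * u ^ 2) * (u - 1 - x * u) = x ^ 2 * u ^ 2 * (u - 1) ^ 2 := by
    rw [h4, h3, h1]
    linear_combination -u ^ 4 * hK - u ^ 3 * (v - v ^ 2 - x) * (1 - v - x) * hu
  -- Try weights A (u - 1) u ^ k and B (u - 1) u ^ k for flags false and true. Cancelling the u ^ k
  -- terms at flag true forces x u (u - 1) A = (u - 1 - x u) B, whence the choice of A and B; at
  -- flag false it becomes `hker`. The u ^ 2 terms left over are the corrections α and β.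
  have hrel := flagGF_relation_of_childSum
    (fun k b => (bif b then x * u * (u - 1) else u - 1 - x * u) * (u - 1) * u ^ k)
    (x * (u - 1 - x * u) * u ^ 2) (-(x * u ^ 2 * (u - 2) * (x * u * (u - 1)))) ?_
  · simp only [cond_false, h1, h2] at hrel
    have h5 : (v * u) ^ 3 = 1 := by rw [hu, one_pow]
    have h6 : (v * u) ^ 5 = 1 := by rw [hu, one_pow]
    linear_combination v ^ 5 * hrel
      - (x * v ^ 2 * (1 - v - x) * flagGF false - v ^ 2 * (1 - v - x) * (1 - v)) * h5
      + x ^ 2 * (1 - v) * (1 - 2 * v) * flagGF true * h6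
  · intro k b hk
    have hgeom := geom_sum_Ico_mul u (show 2 ≤ k + 1 by omega)
    rw [hx]
    cases b
    · simp only [childSum, cond_false, cond_true, ← Finset.mul_sum]
      linear_combination x * (u - 1 - x * u) * hgeom - u ^ k * hker
    · simp only [childSum, cond_true, cond_false, ← Finset.mul_sum]
      linear_combination x * (x * u * (u - 1)) * hgeom

/-! ### The two roots and the golden ratio -/

/-- The golden ratio as a constant power series. -/
noncomputable def goldenSeries : ℝ⟦X⟧ := PowerSeries.C ((1 + √5) / 2)

theorem goldenSeries_sq : goldenSeries ^ 2 = goldenSeries + 1 := by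
  rw [goldenSeries, ← map_pow, ← map_one PowerSeries.C, ← map_add]
  congr 1
  have := Real.sq_sqrt (show (0 : ℝ) ≤ 5 by norm_num)
  linear_combination this / 4

theorem two_mul_goldenSeries : 2 * goldenSeries = 1 + PowerSeries.C √5 := by
  rw [goldenSeries, ← map_ofNat PowerSeries.C 2, ← map_one PowerSeries.C, ← map_add, ← map_mul]
  congr 1
  ring

theorem C_sqrt_five_sq : (PowerSeries.C √5 : ℝ⟦X⟧) ^ 2 = 5 := by
  rw [← map_pow, Real.sq_sqrt (by norm_num), map_ofNat]

theorem four_mul_C_quarter_mul (f : ℝ⟦X⟧) : 4 * (PowerSeries.C (1 / 4) * f) = f := by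
  rw [← mul_assoc, ← map_ofNat PowerSeries.C 4, ← map_mul]
  norm_num

theorem sqrt_four : √(4 : ℝ) = 2 := by
  rw [show (4 : ℝ) = 2 ^ 2 by norm_num, Real.sqrt_sq (by norm_num)]

theorem sixteen_ne_zero : (16 : ℝ⟦X⟧) ≠ 0 := fun h => by
  have := congrArg PowerSeries.constantCoeff h
  rw [map_ofNat, map_zero] at this
  norm_num at this

theorem constantCoeff_vMinus : PowerSeries.constantCoeff vMinus = 1 := by
  rw [vMinus, map_mul, map_add, constantCoeff_seriesSqrt (by simp [map_ofNat])]
  simp [map_ofNat, sqrt_four]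
  norm_num

theorem constantCoeff_vPlus : PowerSeries.constantCoeff vPlus = 1 := by
  rw [vPlus, map_mul, map_add, constantCoeff_seriesSqrt (by simp [map_ofNat])]
  simp [map_ofNat, sqrt_four]
  norm_num

theorem vMinus_quadratic : vMinus * (1 - vMinus - PowerSeries.X) =
    goldenSeries * PowerSeries.X * (1 - vMinus) := by
  have h := four_mul_C_quarter_mul (2 + PowerSeries.C (√5 - 1) * PowerSeries.X +
      seriesSqrt (4 - 12 * PowerSeries.X + 6 * PowerSeries.X ^ 2
        - PowerSeries.C (4 * √5) * PowerSeries.X - PowerSeries.C (2 * √5) * PowerSeries.X ^ 2))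
  have hsq := seriesSqrt_sq (f := 4 - 12 * PowerSeries.X + 6 * PowerSeries.X ^ 2
        - PowerSeries.C (4 * √5) * PowerSeries.X - PowerSeries.C (2 * √5) * PowerSeries.X ^ 2)
        (by simp [map_ofNat])
  rw [← vMinus, ← sub_eq_iff_eq_add'] at h
  rw [← h] at hsq
  simp only [map_mul, map_sub, map_one, map_ofNat] at hsq
  refine mul_left_cancel₀ sixteen_ne_zero ?_
  linear_combination PowerSeries.X ^ 2 * C_sqrt_five_sq - hsq
    - 8 * PowerSeries.X * (1 - vMinus) * two_mul_goldenSeries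

theorem vPlus_quadratic : vPlus * (1 - vPlus - PowerSeries.X) =
    (1 - goldenSeries) * PowerSeries.X * (1 - vPlus) := by
  have h := four_mul_C_quarter_mul (2 - PowerSeries.C (√5 + 1) * PowerSeries.X +
      seriesSqrt (4 - 12 * PowerSeries.X + 6 * PowerSeries.X ^ 2
        + PowerSeries.C (4 * √5) * PowerSeries.X + PowerSeries.C (2 * √5) * PowerSeries.X ^ 2))
  have hsq := seriesSqrt_sq (f := 4 - 12 * PowerSeries.X + 6 * PowerSeries.X ^ 2
        + PowerSeries.C (4 * √5) * PowerSeries.X + PowerSeries.C (2 * √5) * PowerSeries.X ^ 2)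
        (by simp [map_ofNat])
  rw [← vPlus, ← sub_eq_iff_eq_add'] at h
  rw [← h] at hsq
  simp only [map_mul, map_add, map_one, map_ofNat] at hsq
  refine mul_left_cancel₀ sixteen_ne_zero ?_
  linear_combination PowerSeries.X ^ 2 * C_sqrt_five_sq - hsq
    + 8 * PowerSeries.X * (1 - vPlus) * two_mul_goldenSeries

/-- With p = v (1 - v - X) and q = X (1 - v) the kernel is -(p² - p q - q²), which splits over the
golden ratio and its conjugate. -/
theorem kernelK_eq_neg_mul (v : ℝ⟦X⟧) : kernelK v =
    -((v * (1 - v - PowerSeries.X) - goldenSeries * PowerSeries.X * (1 - v)) *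
      (v * (1 - v - PowerSeries.X) - (1 - goldenSeries) * PowerSeries.X * (1 - v))) := by
  rw [kernelK]
  linear_combination -PowerSeries.X ^ 2 * (1 - v) ^ 2 * goldenSeries_sq

theorem kernelK_vMinus : kernelK vMinus = 0 := by
  rw [kernelK_eq_neg_mul, vMinus_quadratic]
  ring

theorem kernelK_vPlus : kernelK vPlus = 0 := by
  rw [kernelK_eq_neg_mul, vPlus_quadratic]
  ring

theorem one_sub_ne_zero_of_quadratic {v c : ℝ⟦X⟧}
    (h : v * (1 - v - PowerSeries.X) = c * PowerSeries.X * (1 - v)) : 1 - v ≠ 0 := by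
  intro h0
  rw [sub_eq_zero] at h0
  subst h0
  exact PowerSeries.X_ne_zero (R := ℝ) (by linear_combination -h)

theorem flagGF_relation_of_quadratic {v c c' : ℝ⟦X⟧} (hv : PowerSeries.constantCoeff v = 1)
    (hK : kernelK v = 0) (hc : c * c' = -1)
    (h : v * (1 - v - PowerSeries.X) = c * PowerSeries.X * (1 - v)) :
    v * (PowerSeries.X * flagGF false) + c' * (1 - 2 * v) * (PowerSeries.X * flagGF true) =
      v * (1 - v) := by
  refine mul_left_cancel₀
    (mul_ne_zero (PowerSeries.X_ne_zero (R := ℝ)) (one_sub_ne_zero_of_quadratic h)) ?_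
  have hrel := flagGF_relation_of_kernelK hv hK
  linear_combination -c' * hrel +
    c' * v * (PowerSeries.X * flagGF false - (1 - v)) * h
    + PowerSeries.X * (1 - v) * v * (PowerSeries.X * flagGF false - (1 - v)) * hc

/-! ### Elimination -/

/-- Cramer's rule in cleared form: the factor a φ (1 - 2b) - b (1 - φ) (1 - 2a) is the determinant
of the two linear equations, and the first factor on the left is the determinant times the value of
the generating function. -/
theorem kernel_elimination {R : Type*} [CommRing R] {a b x φ : R}
    (hφ : φ ^ 2 = φ + 1) (ha : a * (1 - a - x) = φ * x * (1 - a))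
    (hb : b * (1 - b - x) = (1 - φ) * x * (1 - b)) :
    (a * φ * (1 - 2 * b) - b * (1 - φ) * (1 - 2 * a) + a * (1 - a) * φ * (1 - 2 * b)
      - b * (1 - b) * (1 - φ) * (1 - 2 * a) + a * b * (a - b)) *
      (x * (x - (a - 1) * (b - 1) * (a ^ 2 + b ^ 2 + a * b + x * (a + b + 2 - x)))) =
    (a * φ * (1 - 2 * b) - b * (1 - φ) * (1 - 2 * a)) * ((a - 1) * (b - 1) *
      ((a + b) * (a ^ 2 + b ^ 2 - x ^ 2) + (x - 1) * (a ^ 2 + b ^ 2 + a * b))) := by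
  grind

theorem avoidersGF_relation :
    avoidersGF patternsT * (PowerSeries.X * (PowerSeries.X - (vMinus - 1) * (vPlus - 1) *
      (vMinus ^ 2 + vPlus ^ 2 + vMinus * vPlus +
        PowerSeries.X * (vMinus + vPlus + 2 - PowerSeries.X)))) =
    (vMinus - 1) * (vPlus - 1) * ((vMinus + vPlus) * (vMinus ^ 2 + vPlus ^ 2 - PowerSeries.X ^ 2) +
      (PowerSeries.X - 1) * (vMinus ^ 2 + vPlus ^ 2 + vMinus * vPlus)) := by
  have hE := flagGF_relation_of_quadratic constantCoeff_vMinus kernelK_vMinus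
    (c' := 1 - goldenSeries) (by linear_combination -goldenSeries_sq) vMinus_quadratic
  have hE' := flagGF_relation_of_quadratic constantCoeff_vPlus kernelK_vPlus
    (c' := goldenSeries) (by linear_combination -goldenSeries_sq) vPlus_quadratic
  have hel := kernel_elimination goldenSeries_sq vMinus_quadratic vPlus_quadratic
  have hF := avoidersGF_eq_flagGF
  -- The constant term is 1 - 2φ = -√5.
  have hdet : vMinus * goldenSeries * (1 - 2 * vPlus) -
      vPlus * (1 - goldenSeries) * (1 - 2 * vMinus) ≠ 0 := by
    intro h
    have := congrArg PowerSeries.constantCoeff h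
    simp only [map_sub, map_mul, constantCoeff_vMinus, constantCoeff_vPlus, goldenSeries, map_one,
      PowerSeries.constantCoeff_C, map_ofNat, map_zero] at this
    have h5 : 0 < √(5 : ℝ) := by positivity
    linarith
  refine mul_left_cancel₀ hdet ?_
  generalize goldenSeries = φ at *
  generalize vMinus = a at *
  generalize vPlus = b at *
  rw [← hel, hF, ← mul_assoc]
  congr 1
  linear_combination (φ * (1 - 2 * b) - b) * hE + (a - (1 - φ) * (1 - 2 * a)) * hE'

theorem denominator_ne_zero :
    PowerSeries.X * (PowerSeries.X - (vMinus - 1) * (vPlus - 1) *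
      (vMinus ^ 2 + vPlus ^ 2 + vMinus * vPlus +
        PowerSeries.X * (vMinus + vPlus + 2 - PowerSeries.X))) ≠ 0 := by
  obtain ⟨f, hf⟩ : PowerSeries.X ∣ vMinus - 1 := by
    rw [PowerSeries.X_dvd_iff]; simp [constantCoeff_vMinus]
  obtain ⟨g, hg⟩ : PowerSeries.X ∣ vPlus - 1 := by
    rw [PowerSeries.X_dvd_iff]; simp [constantCoeff_vPlus]
  refine mul_ne_zero PowerSeries.X_ne_zero fun h => ?_
  rw [hf, hg] at h
  -- As v₋ - 1 and v₊ - 1 are both divisible by X, their product is O(X²), so the linear term X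
  -- survives.
  have h' : PowerSeries.X * (1 - PowerSeries.X * (f * g *
      (vMinus ^ 2 + vPlus ^ 2 + vMinus * vPlus +
        PowerSeries.X * (vMinus + vPlus + 2 - PowerSeries.X)))) = 0 := by
    rw [← h]; ring
  have := congrArg PowerSeries.constantCoeff
    ((mul_eq_zero.1 h').resolve_left PowerSeries.X_ne_zero)
  simp at this

theorem mainTheorem1 :
    kernelK vMinus = 0 ∧ kernelK vPlus = 0 ∧
    ∀ x vm vp : ℝ⸨X⸩,
      x = ((PowerSeries.X : ℝ⟦X⟧) : ℝ⸨X⸩) →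
      vm = (vMinus : ℝ⸨X⸩) →
      vp = (vPlus : ℝ⸨X⸩) →
      x * (x - (vm - 1) * (vp - 1) *
          (vm ^ 2 + vp ^ 2 + vm * vp + x * (vm + vp + 2 - x))) ≠ 0 ∧
      (avoidersGF patternsT : ℝ⸨X⸩) =
        ((vm - 1) * (vp - 1) *
          ((vm + vp) * (vm ^ 2 + vp ^ 2 - x ^ 2) + (x - 1) * (vm ^ 2 + vp ^ 2 + vm * vp))) /
        (x * (x - (vm - 1) * (vp - 1) *
          (vm ^ 2 + vp ^ 2 + vm * vp + x * (vm + vp + 2 - x)))) := by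
  refine ⟨kernelK_vMinus, kernelK_vPlus, ?_⟩
  rintro x vm vp rfl rfl rfl
  have hden := (map_ne_zero_iff (HahnSeries.ofPowerSeries ℤ ℝ)
    HahnSeries.ofPowerSeries_injective).2 denominator_ne_zero
  have hrel := congrArg (HahnSeries.ofPowerSeries ℤ ℝ) avoidersGF_relation
  simp only [map_mul, map_sub, map_add, map_pow, map_one, map_ofNat] at hden hrel
  exact ⟨hden, (eq_div_iff hden).2 hrel⟩
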